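/- Theorem 2 (Zone theorem in three dimensions). Let $\mathcal A$ be a set of $n$ planes in $\mathbb R^3$ in general position: no two of the planes are parallel, any three of them meet in exactly one point, and no four of them have a common point. The cells of $\mathcal A$ are the connected components of $\mathbb R^3\setminus\bigcup_{P\in\mathcal A}P$, and the faces of $\mathcal A$ are, for each $P\in\mathcal A$, the connected components of $P\setminus\bigcup_{Q\in\mathcal A,\,Q\ne P}Q$. For a cell $C$, let $F_C$ be the set of faces of $\mathcal A$ contained in the boundary of $C$. Let $S$ be a plane in $\mathbb R^3$ that is not in $\mathcal A$, let $\mathrm{zone}(S)$ be the set of cells $C$ with $C\cap S\neq\emptyset$, and let $|\mathrm{zone}(S)|=\sum_{C\in\mathrm{zone}(S)}|F_C|$. Then $\mathrm{zone}(S)$ and all the sets $F_C$, $C\in\mathrm{zone}(S)$, are finite and $$|\mathrm{zone}(S)|=O(n^2),$$ that is, there is an absolute constant $c$ such that $|\mathrm{zone}(S)|\le c\,n^2$ for all $n$, all such $\mathcal A$ and all such $S$. -/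

import Mathlib

namespace PlaneArrangement

/-- Three-dimensional Euclidean space. -/
abbrev E3 : Type := EuclideanSpace ℝ (Fin 3)

/-- A plane in `ℝ³`: a two-dimensional affine subspace (the empty subspace has direction `⊥`, so a
plane is automatically nonempty). -/
def IsPlane (P : AffineSubspace ℝ E3) : Prop :=
  Module.finrank ℝ P.direction = 2

/-- General position: no two of the planes are parallel, any three of them meet in exactly one
point (in particular they share no line), and no four of them have a common point. -/
structure GeneralPosition (A : Finset (AffineSubspace ℝ E3)) : Prop where
  not_parallel : ∀ P ∈ A, ∀ Q ∈ A, P ≠ Q → ¬ P.Parallel Q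
  three : ∀ P ∈ A, ∀ Q ∈ A, ∀ R ∈ A, P ≠ Q → P ≠ R → Q ≠ R →
    ∃! x : E3, x ∈ P ∧ x ∈ Q ∧ x ∈ R
  four : ∀ P ∈ A, ∀ Q ∈ A, ∀ R ∈ A, ∀ T ∈ A,
    P ≠ Q → P ≠ R → P ≠ T → Q ≠ R → Q ≠ T → R ≠ T →
    ¬ ∃ x : E3, x ∈ P ∧ x ∈ Q ∧ x ∈ R ∧ x ∈ T

/-- The points of `ℝ³` that lie on no plane of the arrangement. -/
def complementSet (A : Finset (AffineSubspace ℝ E3)) : Set E3 :=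
  {x | ∀ P ∈ A, x ∉ P}

/-- The (open) cells: the connected components of the complement of the union of the planes. -/
def cells (A : Finset (AffineSubspace ℝ E3)) : Set (Set E3) :=
  {C | ∃ x ∈ complementSet A, C = connectedComponentIn (complementSet A) x}

/-- The points of `P` that lie on no other plane of the arrangement. -/
def planeComplement (A : Finset (AffineSubspace ℝ E3)) (P : AffineSubspace ℝ E3) : Set E3 :=
  {x | x ∈ P ∧ ∀ Q ∈ A, Q ≠ P → x ∉ Q}

/-- The (relatively open, two-dimensional) faces of the arrangement: the regions into which a plane
of the arrangement is divided by the other planes. -/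
def faces (A : Finset (AffineSubspace ℝ E3)) : Set (Set E3) :=
  {F | ∃ P ∈ A, ∃ x ∈ planeComplement A P, F = connectedComponentIn (planeComplement A P) x}

/-- The faces of the arrangement that lie on the boundary of `C`. -/
def facesOf (A : Finset (AffineSubspace ℝ E3)) (C : Set E3) : Set (Set E3) :=
  {F | F ∈ faces A ∧ F ⊆ frontier C}

/-- The zone of `S`: the cells of the arrangement that `S` intersects. -/
def zone (A : Finset (AffineSubspace ℝ E3)) (S : AffineSubspace ℝ E3) : Set (Set E3) :=
  {C | C ∈ cells A ∧ (C ∩ (S : Set E3)).Nonempty}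

/-- The size of the zone: the sum, over its cells, of the number of faces on their boundary. -/
noncomputable def zoneSize (A : Finset (AffineSubspace ℝ E3)) (S : AffineSubspace ℝ E3) : ℕ :=
  ∑ᶠ C ∈ zone A S, (facesOf A C).ncard

end PlaneArrangement

/-! A cell is encoded by the signs of affine functionals `f P` vanishing on the planes, and a face
of it by the pair (sign vector, plane); so the zone size is bounded by a sum of cardinalities of
`zoneFamily`.

Delete a plane `h`. Two facets on another plane `i` can merge only if their cells agree except at
`h`; joining witnesses by segments then yields an edge on `i` in the zone of `S ∩ h` within `h`
(`card_zoneFamily_le`). The planar zone is at most linear, `7m + 1` for `m` lines. Averaging the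
deletion inequality over `h`, rather than choosing one `h`, also controls the facets on `h` itself
and gives `8n²` (`sum_card_zoneFamily_le_sq`).

The planar bound comes from directing the line and deleting the last line it crosses: this costs at
most three edges that lie behind their cells (`sum_card_forward_zoneFamily_le`). Both directions
together, plus the at most one parallel line, give the total. -/

namespace PlaneArrangement

/-! ### Sign vectors of affine functionals -/

section SignVectors

variable {ι E : Type*} [AddCommGroup E] [Module ℝ E] (f : ι → E →ᵃ[ℝ] ℝ)

/-- On the index set `J`, the functionals `f j` are nonzero at `x`, and positive exactly for
`j ∈ σ`. -/
def HasSigns (J σ : Finset ι) (x : E) : Prop :=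
  ∀ j ∈ J, (j ∈ σ ∧ 0 < f j x) ∨ (j ∉ σ ∧ f j x < 0)

open Classical in
/-- The sign vectors on `I` (encoded by their sets of positive indices) that are realized on `s`. -/
noncomputable def signFamily (I : Finset ι) (s : Set E) : Finset (Finset ι) :=
  I.powerset.filter fun σ => ∃ x ∈ s, HasSigns f I σ x

variable {f}

lemma mem_signFamily {I σ : Finset ι} {s : Set E} :
    σ ∈ signFamily f I s ↔ σ ⊆ I ∧ ∃ x ∈ s, HasSigns f I σ x := by
  simp [signFamily]

lemma HasSigns.mono {J J' σ : Finset ι} {x : E} (h : HasSigns f J σ x) (hJ : J' ⊆ J) :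
    HasSigns f J' σ x := fun j hj => h j (hJ hj)

lemma HasSigns.congr {J σ τ : Finset ι} {x : E} (h : HasSigns f J σ x)
    (hστ : ∀ j ∈ J, j ∈ τ ↔ j ∈ σ) : HasSigns f J τ x := fun j hj => by
  rw [hστ j hj]; exact h j hj

lemma HasSigns.pos_iff {J σ : Finset ι} {x : E} (h : HasSigns f J σ x) {j : ι} (hj : j ∈ J) :
    0 < f j x ↔ j ∈ σ := by
  rcases h j hj with ⟨h1, h2⟩ | ⟨h1, h2⟩
  · simp [h1, h2]
  · simp [h1, h2.le]

lemma HasSigns.ne_zero {J σ : Finset ι} {x : E} (h : HasSigns f J σ x) {j : ι} (hj : j ∈ J) :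
    f j x ≠ 0 := by
  rcases h j hj with ⟨h1, h2⟩ | ⟨h1, h2⟩
  · exact h2.ne'
  · exact h2.ne

lemma HasSigns.eq_of_pos_iff {I σ τ : Finset ι} {x y : E} (hx : HasSigns f I σ x)
    (hy : HasSigns f I τ y) (hσ : σ ⊆ I) (hτ : τ ⊆ I)
    (h : ∀ j ∈ I, 0 < f j x ↔ 0 < f j y) : σ = τ := by
  ext j
  by_cases hj : j ∈ I
  · rw [← hx.pos_iff hj, ← hy.pos_iff hj, h j hj]
  · exact ⟨fun h' => absurd (hσ h') hj, fun h' => absurd (hτ h') hj⟩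

lemma HasSigns.lineMap {J σ : Finset ι} {x y : E} (hx : HasSigns f J σ x)
    (hy : HasSigns f J σ y) {r : ℝ} (h0 : 0 ≤ r) (h1 : r ≤ 1) :
    HasSigns f J σ (AffineMap.lineMap x y r) := by
  intro j hj
  rw [AffineMap.apply_lineMap, AffineMap.lineMap_apply_module, smul_eq_mul, smul_eq_mul]
  rcases hx j hj with ⟨hσ, hx'⟩ | ⟨hσ, hx'⟩ <;> rcases hy j hj with ⟨hσ', hy'⟩ | ⟨hσ', hy'⟩
  · left
    refine ⟨hσ, ?_⟩
    have := mul_le_mul_of_nonneg_left (min_le_left (f j x) (f j y)) (sub_nonneg.2 h1)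
    have := mul_le_mul_of_nonneg_left (min_le_right (f j x) (f j y)) h0
    have := lt_min hx' hy'
    linarith
  · exact absurd hσ hσ'
  · exact absurd hσ' hσ
  · right
    refine ⟨hσ, ?_⟩
    have := mul_le_mul_of_nonneg_left (le_max_left (f j x) (f j y)) (sub_nonneg.2 h1)
    have := mul_le_mul_of_nonneg_left (le_max_right (f j x) (f j y)) h0
    have := max_lt hx' hy'
    linarith

lemma HasSigns.exists_zero {J σ : Finset ι} {x y : E} {h : ι} {s : Set E} (hs : Convex ℝ s)
    (hxs : x ∈ s) (hys : y ∈ s) (hx : HasSigns f J σ x) (hy : HasSigns f J σ y)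
    (hx0 : 0 < f h x) (hy0 : f h y < 0) :
    ∃ z ∈ s, z ∈ segment ℝ x y ∧ f h z = 0 ∧ HasSigns f J σ z := by
  have hd : 0 < f h x - f h y := by linarith
  have h0 : 0 ≤ f h x / (f h x - f h y) := by positivity
  have h1 : f h x / (f h x - f h y) ≤ 1 := by rw [div_le_one hd]; linarith
  have hz : AffineMap.lineMap x y (f h x / (f h x - f h y)) ∈ segment ℝ x y := by
    rw [segment_eq_image_lineMap]; exact ⟨_, ⟨h0, h1⟩, rfl⟩
  refine ⟨_, hs.segment_subset hxs hys hz, hz, ?_, hx.lineMap hy h0 h1⟩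
  rw [AffineMap.apply_lineMap, AffineMap.lineMap_apply_module, smul_eq_mul, smul_eq_mul]
  field_simp
  ring

lemma card_signFamily_le_one {I : Finset ι} {s : Set E} (hs : s.Subsingleton) :
    (signFamily f I s).card ≤ 1 := by
  rw [Finset.card_le_one]
  intro σ hσ τ hτ
  obtain ⟨hI, x, hx, hxσ⟩ := mem_signFamily.1 hσ
  obtain ⟨hI', y, hy, hyσ⟩ := mem_signFamily.1 hτ
  obtain rfl := hs hx hy
  exact hxσ.eq_of_pos_iff hyσ hI hI' fun _ _ => Iff.rfl

lemma not_wbtw_of_hasSigns {J σ : Finset ι} {x y z : E} {j : ι}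
    (hx : HasSigns f J σ x) (hz : HasSigns f J σ z) (hj : j ∈ J) (hy : f j y = 0) :
    ¬ Wbtw ℝ x y z := by
  rintro ⟨r, ⟨h0, h1⟩, rfl⟩
  exact (hx.lineMap hz h0 h1).ne_zero hj hy

lemma apply_smul_add (g : E →ᵃ[ℝ] ℝ) (t : ℝ) (v p : E) :
    g (t • v + p) = t * g.linear v + g p := by
  simpa using g.map_vadd p (t • v)

/-! ### Deleting one hyperplane -/

variable [DecidableEq ι]

open Classical in
/-- The sign vectors on `I` that are realized on `s` and whose cell within `K` has a facet on the
hyperplane `f i = 0`. -/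
noncomputable def zoneFamily (f : ι → E →ᵃ[ℝ] ℝ) (I : Finset ι) (i : ι) (s K : Set E) :
    Finset (Finset ι) :=
  I.powerset.filter fun σ => (∃ x ∈ s, HasSigns f I σ x) ∧
    ∃ y ∈ K, f i y = 0 ∧ HasSigns f (I.erase i) σ y

lemma mem_zoneFamily {I σ : Finset ι} {i : ι} {s K : Set E} :
    σ ∈ zoneFamily f I i s K ↔ σ ⊆ I ∧ (∃ x ∈ s, HasSigns f I σ x) ∧
      ∃ y ∈ K, f i y = 0 ∧ HasSigns f (I.erase i) σ y := by
  simp [zoneFamily]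

lemma zoneFamily_subset_signFamily (I : Finset ι) (i : ι) (s K : Set E) :
    zoneFamily f I i s K ⊆ signFamily f I s := fun _ h =>
  mem_signFamily.2 ⟨(mem_zoneFamily.1 h).1, (mem_zoneFamily.1 h).2.1⟩

/-- The fibres of `σ ↦ σ.erase h` have at most two elements; `ℬ` counts the fibres and `𝒞` the
doubled ones. -/
lemma card_le_of_erase_of_insert {𝒜 ℬ 𝒞 : Finset (Finset ι)} (h : ι)
    (hℬ : ∀ σ ∈ 𝒜, σ.erase h ∈ ℬ)
    (h𝒞 : ∀ τ ∈ 𝒜, h ∉ τ → insert h τ ∈ 𝒜 → τ ∈ 𝒞) : 𝒜.card ≤ ℬ.card + 𝒞.card := by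
  rw [← Finset.card_memberSubfamily_add_card_nonMemberSubfamily h 𝒜,
    ← Finset.card_union_add_card_inter]
  gcongr
  · intro τ hτ
    rw [Finset.mem_union, Finset.mem_memberSubfamily, Finset.mem_nonMemberSubfamily] at hτ
    rcases hτ with ⟨h1, h2⟩ | ⟨h1, h2⟩
    · simpa [h2] using hℬ _ h1
    · simpa [h2] using hℬ _ h1
  · intro τ hτ
    rw [Finset.mem_inter, Finset.mem_memberSubfamily, Finset.mem_nonMemberSubfamily] at hτ
    exact h𝒞 τ hτ.2.1 hτ.2.2 hτ.1.1

lemma HasSigns.erase {I σ : Finset ι} {h : ι} {J : Finset ι} {x : E} (hx : HasSigns f I σ x)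
    (hJ : J ⊆ I) (hh : h ∉ J) : HasSigns f J (σ.erase h) x :=
  (hx.mono hJ).congr fun j hj => by
    have : j ≠ h := fun e => hh (e ▸ hj)
    simp [this]

lemma HasSigns.of_insert {I σ : Finset ι} {h : ι} {J : Finset ι} {x : E}
    (hx : HasSigns f I (insert h σ) x) (hJ : J ⊆ I) (hh : h ∉ J) : HasSigns f J σ x :=
  (hx.mono hJ).congr fun j hj => by
    have : j ≠ h := fun e => hh (e ▸ hj)
    simp [this]

lemma erase_mem_signFamily {I σ : Finset ι} {h : ι} {s : Set E}
    (hσ : σ ∈ signFamily f I s) : σ.erase h ∈ signFamily f (I.erase h) s := by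
  obtain ⟨hI, x, hx, hxσ⟩ := mem_signFamily.1 hσ
  exact mem_signFamily.2 ⟨Finset.erase_subset_erase _ hI, x, hx,
    hxσ.erase (Finset.erase_subset _ _) (Finset.notMem_erase _ _)⟩

lemma mem_signFamily_of_insert {I τ : Finset ι} {h : ι} {s : Set E} (hs : Convex ℝ s)
    (hh : h ∈ I) (hτ : h ∉ τ) (h1 : τ ∈ signFamily f I s) (h2 : insert h τ ∈ signFamily f I s) :
    τ ∈ signFamily f (I.erase h) (s ∩ {x | f h x = 0}) := by
  obtain ⟨hI, x, hx, hxσ⟩ := mem_signFamily.1 h1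
  obtain ⟨-, y, hy, hyσ⟩ := mem_signFamily.1 h2
  have hx0 : f h x < 0 := by rcases hxσ h hh with h' | h' <;> tauto
  have hy0 : 0 < f h y := (hyσ.pos_iff hh).2 (Finset.mem_insert_self _ _)
  obtain ⟨z, hz, -, hz0, hzσ⟩ := HasSigns.exists_zero hs hy hx
    (hyσ.of_insert (Finset.erase_subset h I) (Finset.notMem_erase _ _))
    (hxσ.mono (Finset.erase_subset h I)) hy0 hx0
  exact mem_signFamily.2 ⟨Finset.subset_erase.2 ⟨hI, hτ⟩, z, ⟨hz, hz0⟩, hzσ⟩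

lemma erase_mem_zoneFamily {I σ : Finset ι} {h i : ι} {s K : Set E}
    (hσ : σ ∈ zoneFamily f I i s K) : σ.erase h ∈ zoneFamily f (I.erase h) i s K := by
  obtain ⟨hI, ⟨x, hx, hxσ⟩, y, hy, hy0, hyσ⟩ := mem_zoneFamily.1 hσ
  refine mem_zoneFamily.2 ⟨Finset.erase_subset_erase _ hI, ⟨x, hx,
    hxσ.erase (Finset.erase_subset _ _) (Finset.notMem_erase _ _)⟩, y, hy, hy0,
    hyσ.erase (Finset.erase_subset_erase _ (Finset.erase_subset _ _)) (by simp)⟩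

/-- The two points of `s` and the two facet points of `K` lie on opposite sides of `h`. Each pair is
joined by its own segment, whose crossing with `h` is the new witness; the facet segment stays in `f
i = 0`. -/
lemma mem_zoneFamily_of_insert {I τ : Finset ι} {h i : ι} {s K : Set E} (hs : Convex ℝ s)
    (hK : Convex ℝ K) (hh : h ∈ I) (hi : i ≠ h) (hτ : h ∉ τ)
    (h1 : τ ∈ zoneFamily f I i s K) (h2 : insert h τ ∈ zoneFamily f I i s K) :
    τ ∈ zoneFamily f (I.erase h) i (s ∩ {x | f h x = 0}) (K ∩ {x | f h x = 0}) := by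
  have hS := mem_signFamily.1 (mem_signFamily_of_insert hs hh hτ
    (zoneFamily_subset_signFamily _ _ _ _ h1) (zoneFamily_subset_signFamily _ _ _ _ h2))
  obtain ⟨-, -, x, hx, hxi, hxσ⟩ := mem_zoneFamily.1 h1
  obtain ⟨-, -, y, hy, hyi, hyσ⟩ := mem_zoneFamily.1 h2
  have hh' : h ∈ I.erase i := Finset.mem_erase.2 ⟨hi.symm, hh⟩
  have hx0 : f h x < 0 := by rcases hxσ h hh' with h' | h' <;> tauto
  have hy0 : 0 < f h y := (hyσ.pos_iff hh').2 (Finset.mem_insert_self _ _)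
  have hsub : (I.erase h).erase i ⊆ I.erase i :=
    Finset.erase_subset_erase _ (Finset.erase_subset _ _)
  obtain ⟨z, hz, hzseg, hz0, hzσ⟩ := HasSigns.exists_zero hK hy hx
    (hyσ.of_insert hsub (by simp)) (hxσ.mono hsub) hy0 hx0
  refine mem_zoneFamily.2 ⟨hS.1, hS.2, z, ⟨hz, hz0⟩, ?_, hzσ⟩
  rw [segment_eq_image_lineMap] at hzseg
  obtain ⟨r, -, rfl⟩ := hzseg
  rw [AffineMap.apply_lineMap, hxi, hyi, AffineMap.lineMap_same_apply]

lemma card_zoneFamily_le {I : Finset ι} {h i : ι} {s K : Set E} (hs : Convex ℝ s)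
    (hK : Convex ℝ K) (hh : h ∈ I) (hi : i ≠ h) :
    (zoneFamily f I i s K).card ≤ (zoneFamily f (I.erase h) i s K).card +
      (zoneFamily f (I.erase h) i (s ∩ {x | f h x = 0}) (K ∩ {x | f h x = 0})).card :=
  card_le_of_erase_of_insert h (fun _ => erase_mem_zoneFamily)
    fun _ h1 hτ h2 => mem_zoneFamily_of_insert hs hK hh hi hτ h1 h2

/-! ### Zones of lines and the averaging argument -/

/-- A line meets at most `|I| + 1` cells. -/
lemma card_signFamily_line_le {p v : E} {s : Set E} (hs : Convex ℝ s)
    (hsv : ∀ x ∈ s, ∃ t : ℝ, x = t • v + p) (I : Finset ι) :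
    (signFamily f I s).card ≤ I.card + 1 := by
  induction I using Finset.induction_on with
  | empty =>
    refine (Finset.card_le_one.2 fun σ hσ τ hτ => ?_).trans (by simp)
    rw [Finset.subset_empty.1 (mem_signFamily.1 hσ).1,
      Finset.subset_empty.1 (mem_signFamily.1 hτ).1]
  | insert h I hh ih =>
    have hI : (insert h I).erase h = I := Finset.erase_insert hh
    rw [Finset.card_insert_of_notMem hh]
    by_cases hv : (f h).linear v = 0
    -- Here `f h` is constant along the line, so `h` splits no cell.
    · refine le_trans (b := (signFamily f I s).card + (∅ : Finset (Finset ι)).card) ?_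
        (by simp; omega)
      refine card_le_of_erase_of_insert h (fun σ hσ => hI ▸ erase_mem_signFamily hσ) ?_
      intro τ h1 hτ h2
      exfalso
      obtain ⟨-, x, hx, hxσ⟩ := mem_signFamily.1 h1
      obtain ⟨-, y, hy, hyσ⟩ := mem_signFamily.1 h2
      obtain ⟨t, rfl⟩ := hsv x hx
      obtain ⟨t', rfl⟩ := hsv y hy
      have hx0 := hxσ.pos_iff (Finset.mem_insert_self h I)
      have hy0 := hyσ.pos_iff (Finset.mem_insert_self h I)
      have e : ∀ t : ℝ, f h (t • v + p) = f h p := fun t => by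
        have := (f h).map_vadd p (t • v)
        simpa [hv] using this
      rw [e] at hx0 hy0
      exact hτ (hx0.1 (hy0.2 (Finset.mem_insert_self _ _)))
    · refine le_trans (b := (signFamily f I s).card +
        (signFamily f I (s ∩ {x | f h x = 0})).card) ?_ ?_
      · refine card_le_of_erase_of_insert h (fun σ hσ => hI ▸ erase_mem_signFamily hσ) ?_
        intro τ h1 hτ h2
        have := mem_signFamily_of_insert hs (Finset.mem_insert_self _ _) hτ h1 h2
        rwa [hI] at this
      · have : (signFamily f I (s ∩ {x | f h x = 0})).card ≤ 1 := by
          apply card_signFamily_le_one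
          rintro x ⟨hx, hx0⟩ y ⟨hy, hy0⟩
          obtain ⟨t, rfl⟩ := hsv x hx
          obtain ⟨t', rfl⟩ := hsv y hy
          have h1 := (f h).map_vadd p (t • v)
          have h2 := (f h).map_vadd p (t' • v)
          simp only [vadd_eq_add, map_smul, smul_eq_mul, Set.mem_ofPred_eq] at h1 h2 hx0 hy0
          rw [hx0] at h1
          rw [hy0] at h2
          have : t = t' := mul_right_cancel₀ hv (by linarith)
          rw [this]
        omega

/-- A collinear set meets the boundary of a cell in at most two points on its facets. -/
lemma sum_card_zoneFamily_le_two {I : Finset ι} {s K : Set E} (hs : s.Subsingleton)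
    (hK : Collinear ℝ K) : ∑ i ∈ I, (zoneFamily f I i s K).card ≤ 2 := by
  classical
  have h1 : ∀ i ∈ I, (zoneFamily f I i s K).card ≤
      if (zoneFamily f I i s K).Nonempty then 1 else 0 := by
    intro i _
    split_ifs with h
    · exact (Finset.card_le_card (zoneFamily_subset_signFamily I i s K)).trans
        (card_signFamily_le_one hs)
    · rw [Finset.not_nonempty_iff_eq_empty.1 h]; simp
  refine (Finset.sum_le_sum h1).trans ?_
  rw [← Finset.sum_filter, Finset.sum_const, smul_eq_mul, mul_one]
  -- Only one sign vector occurs. Of three collinear points on three different facets, the middle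
  -- one is a zero of a functional that has the same strict sign at the outer two.
  by_contra! hlt
  obtain ⟨a, ha, b, hb, c, hc, hab, hac, hbc⟩ := Finset.two_lt_card.1 hlt
  rw [Finset.mem_filter] at ha hb hc
  obtain ⟨haI, σ, hσ⟩ := ha
  obtain ⟨hbI, σ', hσ'⟩ := hb
  obtain ⟨hcI, σ'', hσ''⟩ := hc
  have hone := Finset.card_le_one.1 (card_signFamily_le_one (f := f) (I := I) hs)
  obtain rfl := hone _ (zoneFamily_subset_signFamily _ _ _ _ hσ) _
    (zoneFamily_subset_signFamily _ _ _ _ hσ')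
  obtain rfl := hone _ (zoneFamily_subset_signFamily _ _ _ _ hσ) _
    (zoneFamily_subset_signFamily _ _ _ _ hσ'')
  obtain ⟨-, -, x, hx, hxa, hxσ⟩ := mem_zoneFamily.1 hσ
  obtain ⟨-, -, y, hy, hyb, hyσ⟩ := mem_zoneFamily.1 hσ'
  obtain ⟨-, -, z, hz, hzc, hzσ⟩ := mem_zoneFamily.1 hσ''
  have hcol : Collinear ℝ {x, y, z} := hK.subset (by
    rintro w (rfl | rfl | rfl) <;> assumption)
  have key : ∀ {i k l : ι} {x y z : E}, i ∈ I → i ≠ k → i ≠ l → f i y = 0 →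
      HasSigns f (I.erase k) σ x → HasSigns f (I.erase l) σ z → ¬ Wbtw ℝ x y z := by
    intro i k l x y z hi hk hl hy hx hz
    exact not_wbtw_of_hasSigns (J := {i})
      (hx.mono (by simp [hi, hk])) (hz.mono (by simp [hi, hl]))
      (Finset.mem_singleton_self i) hy
  rcases hcol.wbtw_or_wbtw_or_wbtw with h | h | h
  · exact key hbI hab.symm hbc hyb hxσ hzσ h
  · exact key hcI hbc.symm hac.symm hzc hyσ hxσ h
  · exact key haI hac hab hxa hzσ hyσ h

open Classical in
/-- In a planar arrangement, the cells met by a directed line have altogether at most `3 |I|` edges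
that they lie ahead of. -/
lemma sum_card_forward_zoneFamily_le {p v : E} {s K : Set E} (hs : Convex ℝ s) (hK : Convex ℝ K)
    (hsv : ∀ x ∈ s, ∃ t : ℝ, x = t • v + p) (I : Finset ι)
    (hcol : ∀ h ∈ I, Collinear ℝ (K ∩ {x | f h x = 0})) :
    ∑ i ∈ I with (f i).linear v ≠ 0,
      ((zoneFamily f I i s K).filter fun σ => i ∈ σ ↔ 0 < (f i).linear v).card ≤ 3 * I.card := by
  induction hn : I.card generalizing I with
  | zero => rw [Finset.card_eq_zero.1 hn]; simp
  | succ n ih =>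
  rcases (I.filter fun i => (f i).linear v ≠ 0).eq_empty_or_nonempty with h0 | hne
  · rw [h0]; simp
  -- `h` is the last hyperplane crossed in direction `v`.
  obtain ⟨h, hh, hmax⟩ := Finset.exists_max_image _ (fun i => - f i p / (f i).linear v) hne
  obtain ⟨hhI, hhv⟩ := Finset.mem_filter.1 hh
  have hsub : (s ∩ {x | f h x = 0}).Subsingleton := by
    rintro x ⟨hx, hx0⟩ y ⟨hy, hy0⟩
    obtain ⟨t, rfl⟩ := hsv x hx
    obtain ⟨t', rfl⟩ := hsv y hy
    simp only [Set.mem_ofPred_eq, apply_smul_add] at hx0 hy0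
    have : t = t' := mul_right_cancel₀ hhv (by linarith)
    rw [this]
  have hcross := sum_card_zoneFamily_le_two (f := f) (I := I.erase h) hsub (hcol h hhI)
  have hrec := ih (I.erase h) (fun j hj => hcol j (Finset.mem_of_mem_erase hj))
    (by rw [Finset.card_erase_of_mem hhI, hn]; rfl)
  have hlast : ((zoneFamily f I h s K).filter fun σ => h ∈ σ ↔ 0 < (f h).linear v).card ≤ 1 := by
    -- Past the last crossing every sign is determined: by the slope along `v`, or by the value at
    -- `p` if the slope is zero. So only one cell lies beyond `h`.
    have hpos : ∀ σ x, HasSigns f I σ x → x ∈ s → (h ∈ σ ↔ 0 < (f h).linear v) →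
        ∀ j ∈ I, 0 < f j x ↔ (0 < (f j).linear v ∨ ((f j).linear v = 0 ∧ 0 < f j p)) := by
      intro σ x hx hxs hσ j hj
      obtain ⟨t, rfl⟩ := hsv x hxs
      have ht : - f h p / (f h).linear v < t := by
        rw [← hx.pos_iff hhI, apply_smul_add] at hσ
        have h1 := hx.ne_zero hhI
        rw [apply_smul_add] at h1
        rcases lt_or_gt_of_ne hhv with hv | hv
        · rw [div_lt_iff_of_neg hv]
          have : ¬ 0 < t * (f h).linear v + f h p := fun h' => hv.not_gt (hσ.1 h')
          have := lt_of_le_of_ne (not_lt.1 this) h1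
          linarith
        · rw [div_lt_iff₀ hv]
          have := hσ.2 hv
          linarith
      rw [apply_smul_add]
      rcases lt_trichotomy ((f j).linear v) 0 with hv | hv | hv
      · have := (hmax j (Finset.mem_filter.2 ⟨hj, hv.ne⟩)).trans_lt ht
        rw [div_lt_iff_of_neg hv] at this
        simp only [hv.not_gt, hv.ne, false_and, or_self, iff_false]
        linarith
      · simp [hv]
      · have := (hmax j (Finset.mem_filter.2 ⟨hj, hv.ne'⟩)).trans_lt ht
        rw [div_lt_iff₀ hv] at this
        simp only [hv, true_or, iff_true]
        linarith
    rw [Finset.card_le_one]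
    intro σ hσ τ hτ
    obtain ⟨hσ, hσh⟩ := Finset.mem_filter.1 hσ
    obtain ⟨hτ, hτh⟩ := Finset.mem_filter.1 hτ
    obtain ⟨hI, ⟨x, hx, hxσ⟩, -⟩ := mem_zoneFamily.1 hσ
    obtain ⟨hI', ⟨y, hy, hyσ⟩, -⟩ := mem_zoneFamily.1 hτ
    exact hxσ.eq_of_pos_iff hyσ hI hI' fun j hj =>
      (hpos σ x hxσ hx hσh j hj).trans (hpos τ y hyσ hy hτh j hj).symm
  rw [← Finset.add_sum_erase _ _ hh, ← Finset.filter_erase]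
  have hstep : ∀ i ∈ (I.erase h).filter fun i => (f i).linear v ≠ 0,
      ((zoneFamily f I i s K).filter fun σ => i ∈ σ ↔ 0 < (f i).linear v).card ≤
      ((zoneFamily f (I.erase h) i s K).filter fun σ => i ∈ σ ↔ 0 < (f i).linear v).card +
      (zoneFamily f (I.erase h) i (s ∩ {x | f h x = 0}) (K ∩ {x | f h x = 0})).card := by
    intro i hi
    have hih : i ≠ h := Finset.ne_of_mem_erase (Finset.mem_filter.1 hi).1
    refine card_le_of_erase_of_insert h ?_ ?_
    · intro σ hσ
      rw [Finset.mem_filter] at hσ ⊢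
      exact ⟨erase_mem_zoneFamily hσ.1, by simpa [hih] using hσ.2⟩
    · intro τ h1 hτ h2
      exact mem_zoneFamily_of_insert hs hK hhI hih hτ (Finset.mem_filter.1 h1).1
        (Finset.mem_filter.1 h2).1
  have hsum := Finset.sum_le_sum hstep
  rw [Finset.sum_add_distrib] at hsum
  have hle := Finset.sum_le_sum_of_subset (f := fun i => (zoneFamily f (I.erase h) i
    (s ∩ {x | f h x = 0}) (K ∩ {x | f h x = 0})).card)
    (Finset.filter_subset (fun i => (f i).linear v ≠ 0) (I.erase h))
  -- Three new edges per hyperplane: at most one on `h` and two from edges that `h` cuts.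
  omega

/-- The zone theorem for a line in a planar arrangement in which at most one line is parallel to the
given one. -/
lemma sum_card_zoneFamily_line_le {p v : E} {s K : Set E} (hs : Convex ℝ s) (hK : Convex ℝ K)
    (hsv : ∀ x ∈ s, ∃ t : ℝ, x = t • v + p) (I : Finset ι)
    (hcol : ∀ h ∈ I, Collinear ℝ (K ∩ {x | f h x = 0}))
    (hpar : ∀ i ∈ I, ∀ j ∈ I, (f i).linear v = 0 → (f j).linear v = 0 → i = j) :
    ∑ i ∈ I, (zoneFamily f I i s K).card ≤ 7 * I.card + 1 := by
  classical
  have h1 := sum_card_forward_zoneFamily_le hs hK hsv I hcol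
  have h2 := sum_card_forward_zoneFamily_le (v := -v) (p := p) hs hK
    (fun x hx => by
      obtain ⟨t, rfl⟩ := hsv x hx
      exact ⟨-t, by simp⟩) I hcol
  have h3 : ∑ i ∈ I with ¬ (f i).linear v ≠ 0, (zoneFamily f I i s K).card ≤ I.card + 1 := by
    refine (Finset.sum_le_card_nsmul _ _ (I.card + 1) fun i _ =>
      (Finset.card_le_card (zoneFamily_subset_signFamily I i s K)).trans
        (card_signFamily_line_le hs hsv I)).trans ?_
    have : (I.filter fun i => ¬ (f i).linear v ≠ 0).card ≤ 1 := by
      rw [Finset.card_le_one]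
      intro i hi j hj
      rw [Finset.mem_filter, not_not] at hi hj
      exact hpar i hi.1 j hj.1 hi.2 hj.2
    rw [smul_eq_mul]
    nlinarith
  simp only [map_neg, neg_ne_zero, Left.neg_pos_iff] at h2
  rw [← Finset.sum_filter_add_sum_filter_not I (fun i => (f i).linear v ≠ 0)]
  -- Each cell lies beyond its edge in direction `v` or in direction `-v`.
  have h4 : ∑ i ∈ I with (f i).linear v ≠ 0, (zoneFamily f I i s K).card ≤
      ∑ i ∈ I with (f i).linear v ≠ 0,
        (((zoneFamily f I i s K).filter fun σ => i ∈ σ ↔ 0 < (f i).linear v).card +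
        ((zoneFamily f I i s K).filter fun σ => i ∈ σ ↔ (f i).linear v < 0).card) := by
    refine Finset.sum_le_sum fun i hi => ?_
    refine le_trans (Finset.card_le_card fun σ hσ => ?_) (Finset.card_union_le _ _)
    have hv := (Finset.mem_filter.1 hi).2
    rw [Finset.mem_union, Finset.mem_filter, Finset.mem_filter]
    rcases lt_or_gt_of_ne hv with hv | hv <;> by_cases hiσ : i ∈ σ <;>
      simp [hσ, hiσ, hv, hv.le]
  rw [Finset.sum_add_distrib] at h4
  omega

/-- If every planar section has a zone of linear size, the zone has quadratic size. -/
lemma sum_card_zoneFamily_le_sq {s K : Set E} (hs : Convex ℝ s) (hK : Convex ℝ K) (A : Finset ι)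
    (hA : ∀ h ∈ A, ∀ I ⊆ A.erase h,
      ∑ i ∈ I, (zoneFamily f I i (s ∩ {x | f h x = 0}) (K ∩ {x | f h x = 0})).card ≤
        7 * I.card + 1)
    (I : Finset ι) (hI : I ⊆ A) :
    ∑ i ∈ I, (zoneFamily f I i s K).card ≤ 8 * I.card ^ 2 := by
  induction hn : I.card generalizing I with
  | zero => rw [Finset.card_eq_zero.1 hn]; simp
  | succ n ih =>
  -- Averaging divides by `n`, so a single hyperplane is treated apart; it has at most two sign
  -- vectors.
  rcases Nat.eq_zero_or_pos n with rfl | hpos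
  · obtain ⟨i, rfl⟩ := Finset.card_eq_one.1 hn
    rw [Finset.sum_singleton]
    refine (Finset.card_le_card (t := ({i} : Finset ι).powerset) fun σ hσ =>
      Finset.mem_powerset.2 (mem_zoneFamily.1 hσ).1).trans ?_
    simp
  -- Each facet survives the deletion of every hyperplane but its own, so it is counted `n` times.
  have key : n * ∑ i ∈ I, (zoneFamily f I i s K).card =
      ∑ h ∈ I, ∑ i ∈ I.erase h, (zoneFamily f I i s K).card := by
    have h1 : ∀ h ∈ I, ∑ i ∈ I.erase h, (zoneFamily f I i s K).card +
        (zoneFamily f I h s K).card = ∑ i ∈ I, (zoneFamily f I i s K).card := fun h hh =>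
      Finset.sum_erase_add _ _ hh
    have h2 := Finset.sum_congr rfl h1
    rw [Finset.sum_add_distrib, Finset.sum_const, hn, smul_eq_mul] at h2
    linarith
  have hle : ∀ h ∈ I, ∑ i ∈ I.erase h, (zoneFamily f I i s K).card ≤
      8 * n ^ 2 + (7 * n + 1) := by
    intro h hh
    have hc : (I.erase h).card = n := by rw [Finset.card_erase_of_mem hh, hn]; rfl
    have h1 := ih (I.erase h) ((Finset.erase_subset _ _).trans hI) hc
    have h2 := hA h (hI hh) (I.erase h) (Finset.erase_subset_erase _ hI)
    rw [hc] at h2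
    refine le_trans ?_ (add_le_add h1 h2)
    rw [← Finset.sum_add_distrib]
    exact Finset.sum_le_sum fun i hi =>
      card_zoneFamily_le hs hK hh (Finset.ne_of_mem_erase hi)
  have htot := Finset.sum_le_card_nsmul _ _ _ hle
  rw [← key, hn, smul_eq_mul] at htot
  refine Nat.le_of_mul_le_mul_left (htot.trans ?_) hpos
  -- The inequality needed is `8n² + 7n + 1 ≤ 8n(n + 1)`, which holds as `n ≥ 1`.
  nlinarith

end SignVectors

/-! ### Planes in space and their sections -/

section Geometry

/-- A plane is the zero set of an affine functional. -/
lemma IsPlane.exists_affineMap {P : AffineSubspace ℝ E3} (hP : IsPlane P) :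
    ∃ g : E3 →ᵃ[ℝ] ℝ, (∀ x, g x = 0 ↔ x ∈ P) ∧ ∀ v, g.linear v = 0 ↔ v ∈ P.direction := by
  have hne : (P : Set E3).Nonempty := by
    rw [Set.nonempty_iff_ne_empty]
    intro h
    rw [AffineSubspace.coe_eq_bot_iff] at h
    subst h
    rw [IsPlane, AffineSubspace.direction_bot, finrank_bot] at hP
    omega
  obtain ⟨p, hp⟩ := hne
  have hlt : P.direction < ⊤ := by
    rw [lt_top_iff_ne_top]
    intro h
    rw [IsPlane, h, finrank_top, finrank_euclideanSpace_fin] at hP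
    omega
  obtain ⟨g, hg, hle⟩ := Submodule.exists_le_ker_of_lt_top _ hlt
  have hker : P.direction = LinearMap.ker g := by
    apply Submodule.eq_of_le_of_finrank_le hle
    have h1 := g.finrank_range_add_finrank_ker
    have h2 : Module.finrank ℝ (LinearMap.range g) = 1 := by
      rw [LinearMap.range_eq_top.2 (LinearMap.surjective hg), finrank_top, Module.finrank_self]
    rw [finrank_euclideanSpace_fin] at h1
    rw [show Module.finrank ℝ P.direction = 2 from hP]
    omega
  refine ⟨g.toAffineMap - AffineMap.const ℝ E3 (g p), fun x => ?_, fun v => ?_⟩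
  · rw [← AffineSubspace.vsub_right_mem_direction_iff_mem hp, hker]
    simp
  · rw [hker]
    simp

/-- Two distinct planes with a common point meet in a line. -/
lemma IsPlane.exists_direction_inf {P Q : AffineSubspace ℝ E3} (hP : IsPlane P) (hQ : IsPlane Q)
    (hPQ : P ≠ Q) {p : E3} (hpP : p ∈ P) (hpQ : p ∈ Q) :
    ∃ v ≠ 0, v ∈ P.direction ∧ v ∈ Q.direction ∧ ∀ x ∈ P, x ∈ Q → ∃ t : ℝ, x = t • v + p := by
  have hdim := Submodule.finrank_sup_add_finrank_inf_eq P.direction Q.direction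
  have hsup := Submodule.finrank_le (P.direction ⊔ Q.direction)
  rw [finrank_euclideanSpace_fin] at hsup
  have hlt : P.direction ⊓ Q.direction < P.direction := by
    rw [inf_lt_left]
    intro hle
    have := Submodule.eq_of_le_of_finrank_eq hle
      (Eq.trans (show _ = 2 from hP) (show _ = 2 from hQ).symm)
    exact hPQ (AffineSubspace.ext_of_direction_eq this ⟨p, hpP, hpQ⟩)
  have hlt' := Submodule.finrank_lt_finrank_of_lt hlt
  rw [show Module.finrank ℝ P.direction = 2 from hP] at hdim hlt'
  rw [show Module.finrank ℝ Q.direction = 2 from hQ] at hdim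
  have h1 : Module.finrank ℝ ↥(P.direction ⊓ Q.direction) = 1 := by omega
  obtain ⟨⟨v, hv⟩, hv0, hvs⟩ := finrank_eq_one_iff'.1 h1
  refine ⟨v, fun h => hv0 (Subtype.ext h), hv.1, hv.2, fun x hxP hxQ => ?_⟩
  obtain ⟨t, ht⟩ := hvs ⟨x - p, AffineSubspace.vsub_mem_direction hxP hpP,
    AffineSubspace.vsub_mem_direction hxQ hpQ⟩
  refine ⟨t, ?_⟩
  have : t • v = x - p := congrArg Subtype.val ht
  rw [this, sub_add_cancel]

lemma IsPlane.collinear_inter {P Q : AffineSubspace ℝ E3} (hP : IsPlane P) (hQ : IsPlane Q)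
    (hPQ : P ≠ Q) : Collinear ℝ {x | x ∈ P ∧ x ∈ Q} := by
  rcases Set.eq_empty_or_nonempty {x | x ∈ P ∧ x ∈ Q} with h | ⟨p, hpP, hpQ⟩
  · rw [h]; exact collinear_empty ℝ E3
  · obtain ⟨v, -, -, -, hv⟩ := hP.exists_direction_inf hQ hPQ hpP hpQ
    rw [collinear_iff_exists_forall_eq_smul_vadd]
    exact ⟨p, v, fun x hx => hv x hx.1 hx.2⟩

/-- Translating the common point by `v` gives another common point. This is why at most one further
plane is parallel to the line `S ∩ P`. -/
lemma GeneralPosition.eq_zero_of_mem_direction {A : Finset (AffineSubspace ℝ E3)}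
    (hA : GeneralPosition A) {P Q R : AffineSubspace ℝ E3} (hP : P ∈ A) (hQ : Q ∈ A) (hR : R ∈ A)
    (hPQ : P ≠ Q) (hPR : P ≠ R) (hQR : Q ≠ R) {v : E3} (hvP : v ∈ P.direction)
    (hvQ : v ∈ Q.direction) (hvR : v ∈ R.direction) : v = 0 := by
  obtain ⟨x, ⟨h1, h2, h3⟩, hx⟩ := hA.three P hP Q hQ R hR hPQ hPR hQR
  have := hx (v +ᵥ x) ⟨AffineSubspace.vadd_mem_of_mem_direction hvP h1,
    AffineSubspace.vadd_mem_of_mem_direction hvQ h2,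
    AffineSubspace.vadd_mem_of_mem_direction hvR h3⟩
  simpa using this

open Classical in
lemma sum_card_zoneFamily_plane_le {A : Finset (AffineSubspace ℝ E3)} {S : AffineSubspace ℝ E3}
    (hA : ∀ P ∈ A, IsPlane P) (hgp : GeneralPosition A) (hS : IsPlane S) (hSA : S ∉ A)
    {f : AffineSubspace ℝ E3 → E3 →ᵃ[ℝ] ℝ} (hf : ∀ P ∈ A, ∀ x, f P x = 0 ↔ x ∈ P)
    (hfl : ∀ P ∈ A, ∀ v, (f P).linear v = 0 ↔ v ∈ P.direction) :
    ∑ P ∈ A, (zoneFamily f A P (S : Set E3) Set.univ).card ≤ 8 * A.card ^ 2 := by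
  refine sum_card_zoneFamily_le_sq S.convex convex_univ A (fun P hP I hI => ?_) A subset_rfl
  have hPe : {x | f P x = 0} = (P : Set E3) := Set.ext fun x => hf P hP x
  rw [hPe, Set.univ_inter]
  rcases Set.eq_empty_or_nonempty ((S : Set E3) ∩ P) with h | ⟨p, hpS, hpP⟩
  · rw [h]
    refine le_trans (Finset.sum_nonpos fun i _ => ?_) (Nat.zero_le _)
    rw [Nat.le_zero, Finset.card_eq_zero, Finset.eq_empty_iff_forall_notMem]
    intro σ hσ
    obtain ⟨-, ⟨x, hx, -⟩, -⟩ := mem_zoneFamily.1 hσ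
    exact hx
  have hSP : S ≠ P := fun e => hSA (e ▸ hP)
  obtain ⟨v, hv0, -, hvP, hv⟩ := hS.exists_direction_inf (hA P hP) hSP hpS hpP
  refine sum_card_zoneFamily_line_le (S.convex.inter P.convex) P.convex
    (fun x hx => hv x hx.1 hx.2) I (fun Q hQ => ?_) (fun Q hQ R hR hQv hRv => ?_)
  · obtain ⟨hQP, hQA⟩ := Finset.mem_erase.1 (hI hQ)
    refine ((hA P hP).collinear_inter (hA Q hQA) hQP.symm).subset fun x hx => ?_
    exact ⟨hx.1, (hf Q hQA x).1 hx.2⟩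
  · obtain ⟨hQP, hQA⟩ := Finset.mem_erase.1 (hI hQ)
    obtain ⟨hRP, hRA⟩ := Finset.mem_erase.1 (hI hR)
    by_contra hQR
    exact hv0 (hgp.eq_zero_of_mem_direction hP hQA hRA hQP.symm hRP.symm hQR hvP
      ((hfl Q hQA v).1 hQv) ((hfl R hRA v).1 hRv))

end Geometry

/-! ### Connected components and sign vectors -/

section Components

variable {ι : Type*} {f : ι → E3 →ᵃ[ℝ] ℝ}

lemma pos_iff_of_mem_connectedComponentIn {U : Set E3} {g : E3 →ᵃ[ℝ] ℝ} (hU : ∀ x ∈ U, g x ≠ 0)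
    {x y : E3} (hy : y ∈ connectedComponentIn U x) : 0 < g x ↔ 0 < g y := by
  have hx : x ∈ U := by
    by_contra h
    rw [connectedComponentIn_eq_empty h] at hy
    exact hy
  have hx' := mem_connectedComponentIn hx
  have hc : ContinuousOn g (connectedComponentIn U x) :=
    g.continuous_of_finiteDimensional.continuousOn
  have key : ∀ a ∈ connectedComponentIn U x, ∀ b ∈ connectedComponentIn U x,
      0 < g a → 0 < g b := by
    intro a ha b hb h0
    by_contra h
    obtain ⟨z, hz, hz0⟩ := isPreconnected_connectedComponentIn.intermediate_value hb ha hc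
      ⟨not_lt.1 h, h0.le⟩
    exact hU z (connectedComponentIn_subset U x hz) hz0
  exact ⟨key x hx' y hy, key y hy x hx'⟩

/-- Signs persist along the segment from `x` to `y`, which therefore stays in `U`. -/
lemma connectedComponentIn_eq_of_hasSigns {U K : Set E3} {J σ : Finset ι} (hK : Convex ℝ K)
    (hU : ∀ x, x ∈ U ↔ x ∈ K ∧ ∀ j ∈ J, f j x ≠ 0) {x y : E3} (hxK : x ∈ K) (hyK : y ∈ K)
    (hx : HasSigns f J σ x) (hy : HasSigns f J σ y) :
    connectedComponentIn U x = connectedComponentIn U y := by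
  apply connectedComponentIn_eq
  refine (convex_segment x y).isPreconnected.subset_connectedComponentIn
    (left_mem_segment ℝ x y) (fun z hz => ?_) (right_mem_segment ℝ x y)
  refine (hU z).2 ⟨hK.segment_subset hxK hyK hz, fun j hj => ?_⟩
  rw [segment_eq_image_lineMap] at hz
  obtain ⟨r, ⟨h0, h1⟩, rfl⟩ := hz
  exact (hx.lineMap hy h0 h1).ne_zero hj

lemma hasSigns_iff {J σ : Finset ι} {x : E3} :
    HasSigns f J σ x ↔ ∀ j ∈ J, f j x ≠ 0 ∧ (0 < f j x ↔ j ∈ σ) := by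
  refine ⟨fun h j hj => ⟨h.ne_zero hj, h.pos_iff hj⟩, fun h j hj => ?_⟩
  obtain ⟨h0, h1⟩ := h j hj
  rcases lt_or_gt_of_ne h0 with h2 | h2
  · exact Or.inr ⟨fun h' => h2.not_gt (h1.2 h'), h2⟩
  · exact Or.inl ⟨h1.1 h2, h2⟩

lemma HasSigns.of_mem_connectedComponentIn {U : Set E3} {J σ : Finset ι}
    (hU : ∀ x ∈ U, ∀ j ∈ J, f j x ≠ 0) {x y : E3} (hx : HasSigns f J σ x)
    (hy : y ∈ connectedComponentIn U x) : HasSigns f J σ y := by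
  rw [hasSigns_iff]
  intro j hj
  refine ⟨hU y (connectedComponentIn_subset _ _ hy) j hj, ?_⟩
  rw [← pos_iff_of_mem_connectedComponentIn (fun x hx => hU x hx j hj) hy, hx.pos_iff hj]

lemma hasSigns_filter {J : Finset ι} {x : E3} (hx : ∀ j ∈ J, f j x ≠ 0) :
    HasSigns f J (J.filter fun j => 0 < f j x) x :=
  hasSigns_iff.2 fun j hj => ⟨hx j hj, by simp [hj]⟩

/-- Strict inequalities become weak in the closure; nonvanishing at `y` makes them strict again. -/
lemma HasSigns.of_mem_closure {J σ : Finset ι} {C : Set E3} (hC : ∀ x ∈ C, HasSigns f J σ x)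
    {y : E3} (hy : y ∈ closure C) (hy0 : ∀ j ∈ J, f j y ≠ 0) : HasSigns f J σ y := by
  intro j hj
  have hc : Continuous (f j) := (f j).continuous_of_finiteDimensional
  by_cases hσ : j ∈ σ
  · refine Or.inl ⟨hσ, lt_of_le_of_ne ?_ (hy0 j hj).symm⟩
    exact closure_minimal (t := {z | 0 ≤ f j z})
      (fun z hz => (((hC z hz).pos_iff hj).2 hσ).le) (isClosed_le continuous_const hc) hy
  · refine Or.inr ⟨hσ, lt_of_le_of_ne ?_ (hy0 j hj)⟩
    exact closure_minimal (t := {z | f j z ≤ 0})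
      (fun z hz => not_lt.1 fun h => hσ (((hC z hz).pos_iff hj).1 h))
      (isClosed_le hc continuous_const) hy

end Components

/-! ### From cells and faces to sign vectors -/

section Zone

open Classical in
/-- The number of facets of the cells in the zone is at most the number of their sign-vector
encodings. -/
lemma zoneSize_le_sum_card_zoneFamily {A : Finset (AffineSubspace ℝ E3)}
    (S : AffineSubspace ℝ E3) {f : AffineSubspace ℝ E3 → E3 →ᵃ[ℝ] ℝ}
    (hf : ∀ P ∈ A, ∀ x, f P x = 0 ↔ x ∈ P) :
    (zone A S).Finite ∧ (∀ C ∈ zone A S, (facesOf A C).Finite) ∧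
      zoneSize A S ≤ ∑ P ∈ A, (zoneFamily f A P (S : Set E3) Set.univ).card := by
  have hU : ∀ x, x ∈ complementSet A ↔ x ∈ Set.univ ∧ ∀ P ∈ A, f P x ≠ 0 := fun x => by
    simp only [complementSet, Set.mem_ofPred_eq, Set.mem_univ, true_and]
    exact forall₂_congr fun P hP => not_congr (hf P hP x).symm
  have hV : ∀ P ∈ A, ∀ x, x ∈ planeComplement A P ↔
      x ∈ (P : Set E3) ∧ ∀ Q ∈ A.erase P, f Q x ≠ 0 := fun P hP x => by
    simp only [planeComplement, Set.mem_ofPred_eq, Finset.mem_erase, SetLike.mem_coe]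
    refine and_congr_right fun _ => ⟨fun h Q hQ => ?_, fun h Q hQ hQP => ?_⟩
    · exact fun h0 => h Q hQ.2 hQ.1 ((hf Q hQ.2 x).1 h0)
    · exact fun h0 => h Q ⟨hQP, hQ⟩ ((hf Q hQ x).2 h0)
  have hcell : ∀ C : Set E3, ∃ σ ⊆ A, C ∈ cells A → ∀ x ∈ C, HasSigns f A σ x := by
    intro C
    by_cases hC : C ∈ cells A
    · obtain ⟨x, hx, rfl⟩ := hC
      exact ⟨_, Finset.filter_subset _ _, fun _ y hy =>
        (hasSigns_filter ((hU x).1 hx).2).of_mem_connectedComponentIn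
          (fun z hz => ((hU z).1 hz).2) hy⟩
    · exact ⟨∅, Finset.empty_subset _, fun h => absurd h hC⟩
  choose σ hσA hσ using hcell
  have hinj : Set.InjOn σ (zone A S) := by
    rintro C ⟨hC, -⟩ D ⟨hD, -⟩ hCD
    have h1 := hσ C hC
    have h2 := hσ D hD
    obtain ⟨x, hx, rfl⟩ := hC
    obtain ⟨y, hy, rfl⟩ := hD
    exact connectedComponentIn_eq_of_hasSigns convex_univ hU (Set.mem_univ _) (Set.mem_univ _)
      (h1 x (mem_connectedComponentIn hx)) (hCD ▸ h2 y (mem_connectedComponentIn hy))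
  have hfin : (zone A S).Finite := by
    refine Set.Finite.of_finite_image ((A.powerset.finite_toSet).subset ?_) hinj
    rintro _ ⟨C, -, rfl⟩
    exact Finset.mem_coe.2 (Finset.mem_powerset.2 (hσA C))
  have hface : ∀ F : Set E3, ∃ P, F ∈ faces A → P ∈ A ∧
      ∃ x ∈ planeComplement A P, F = connectedComponentIn (planeComplement A P) x := by
    intro F
    by_cases hF : F ∈ faces A
    · obtain ⟨P, hP, h⟩ := hF
      exact ⟨P, fun _ => ⟨hP, h⟩⟩
    · exact ⟨⊥, fun h => absurd h hF⟩
  choose pl hpl using hface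
  have hsign : ∀ C ∈ zone A S, ∀ F ∈ facesOf A C, ∀ y ∈ F,
      HasSigns f (A.erase (pl F)) (σ C) y := by
    intro C hC F hF y hy
    obtain ⟨hP, x, hx, hFx⟩ := hpl F hF.1
    refine HasSigns.of_mem_closure
      (fun z hz => (hσ C hC.1 z hz).mono (Finset.erase_subset _ _))
      (frontier_subset_closure (hF.2 hy)) ?_
    rw [hFx] at hy
    exact ((hV _ hP y).1 (connectedComponentIn_subset _ _ hy)).2
  have hmem : ∀ C ∈ zone A S, ∀ F ∈ facesOf A C,
      pl F ∈ A.filter fun P => σ C ∈ zoneFamily f A P (S : Set E3) Set.univ := by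
    intro C hC F hF
    obtain ⟨hP, x, hx, hFx⟩ := hpl F hF.1
    obtain ⟨z, hzC, hzS⟩ := hC.2
    have hxF : x ∈ F := by
      have := mem_connectedComponentIn hx
      rwa [← hFx] at this
    exact Finset.mem_filter.2 ⟨hP, mem_zoneFamily.2 ⟨hσA C, ⟨z, hzS, hσ C hC.1 z hzC⟩, x,
      Set.mem_univ _, (hf _ hP x).2 ((hV _ hP x).1 hx).1, hsign C hC F hF x hxF⟩⟩
  -- On a given plane, the faces of `C` carry the signs of `C` for all other planes, so they
  -- coincide.
  have hplinj : ∀ C ∈ zone A S, Set.InjOn pl (facesOf A C) := by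
    intro C hC F hF G hG hFG
    obtain ⟨hP, x, hx, hFx⟩ := hpl F hF.1
    obtain ⟨hQ, y, hy, hGy⟩ := hpl G hG.1
    have h1 := hsign C hC F hF x (by
      have := mem_connectedComponentIn hx
      rwa [← hFx] at this)
    have h2 := hsign C hC G hG y (by
      have := mem_connectedComponentIn hy
      rwa [← hGy] at this)
    rw [hFx, hGy]
    rw [← hFG] at hy h2 ⊢
    exact connectedComponentIn_eq_of_hasSigns (pl F).convex (hV _ hP) ((hV _ hP x).1 hx).1
      ((hV _ hP y).1 hy).1 h1 h2
  refine ⟨hfin, fun C hC => Set.Finite.of_finite_image ((Finset.finite_toSet _).subset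
    (Set.image_subset_iff.2 (hmem C hC))) (hplinj C hC), ?_⟩
  have hcard : ∀ C ∈ zone A S, (facesOf A C).ncard ≤
      (A.filter fun P => σ C ∈ zoneFamily f A P (S : Set E3) Set.univ).card := by
    intro C hC
    rw [← Set.ncard_coe_finset]
    exact Set.ncard_le_ncard_of_injOn pl (hmem C hC) (hplinj C hC) (Finset.finite_toSet _)
  rw [zoneSize, finsum_mem_eq_finite_toFinset_sum _ hfin]
  -- Cells are replaced by their sign vectors, injectively, and the incidences with planes are
  -- counted the other way round.
  calc ∑ C ∈ hfin.toFinset, (facesOf A C).ncard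
      ≤ ∑ C ∈ hfin.toFinset,
          (A.filter fun P => σ C ∈ zoneFamily f A P (S : Set E3) Set.univ).card :=
        Finset.sum_le_sum fun C hC => hcard C (hfin.mem_toFinset.1 hC)
    _ = ∑ τ ∈ hfin.toFinset.image σ,
          (A.filter fun P => τ ∈ zoneFamily f A P (S : Set E3) Set.univ).card := by
        rw [Finset.sum_image]
        simpa using hinj
    _ = ∑ P ∈ A, ((hfin.toFinset.image σ).filter
          fun τ => τ ∈ zoneFamily f A P (S : Set E3) Set.univ).card :=
        Finset.sum_card_bipartiteAbove_eq_sum_card_bipartiteBelow _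
    _ ≤ ∑ P ∈ A, (zoneFamily f A P (S : Set E3) Set.univ).card :=
        Finset.sum_le_sum fun P _ => Finset.card_le_card fun τ hτ => (Finset.mem_filter.1 hτ).2

end Zone

end PlaneArrangement

theorem theorem2 :
    ∃ c : ℕ, ∀ (n : ℕ) (A : Finset (AffineSubspace ℝ PlaneArrangement.E3))
      (S : AffineSubspace ℝ PlaneArrangement.E3),
      A.card = n →
      (∀ P ∈ A, PlaneArrangement.IsPlane P) →
      PlaneArrangement.GeneralPosition A →
      PlaneArrangement.IsPlane S →
      S ∉ A →
      (PlaneArrangement.zone A S).Finite ∧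
      (∀ C ∈ PlaneArrangement.zone A S, (PlaneArrangement.facesOf A C).Finite) ∧
      PlaneArrangement.zoneSize A S ≤ c * n ^ 2 := by

  classical
  refine ⟨8, fun n A S hn hA hgp hS hSA => ?_⟩
  have hex : ∀ P : AffineSubspace ℝ PlaneArrangement.E3, ∃ g : PlaneArrangement.E3 →ᵃ[ℝ] ℝ,
      P ∈ A → (∀ x, g x = 0 ↔ x ∈ P) ∧ ∀ v, g.linear v = 0 ↔ v ∈ P.direction := by
    intro P
    by_cases hP : P ∈ A
    · obtain ⟨g, hg⟩ := (hA P hP).exists_affineMap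
      exact ⟨g, fun _ => hg⟩
    · exact ⟨0, fun h => absurd h hP⟩
  choose f hf using hex
  obtain ⟨h1, h2, h3⟩ := PlaneArrangement.zoneSize_le_sum_card_zoneFamily S
    fun P hP => (hf P hP).1
  refine ⟨h1, h2, h3.trans ?_⟩
  rw [← hn]
  exact PlaneArrangement.sum_card_zoneFamily_plane_le hA hgp hS hSA
    (fun P hP => (hf P hP).1) fun P hP => (hf P hP).2
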